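/- Let $S=\langle a,e \mid ee=e,\ aaa=ae=0,\ eaa=aa\rangle$ be the semigroup with zero presented by the generators $a,e$ and the displayed relations, and let $\mathcal M=S\cup\{1\}$ be the monoid obtained from $S$ by adjoining an identity element $1$. Then $\mathcal M$ has exactly six elements and is of type $2^{\aleph_0}$; that is, the variety of monoids generated by $\mathcal M$ contains uncountably many subvarieties. (A variety of monoids is a class of monoids closed under the formation of homomorphic images, submonoids and arbitrary direct products.) -/

import Mathlib

/-- A variety of monoids: a class of monoids (on types in `Type`) that is closed under
homomorphic images, submonoids, and arbitrary direct products. -/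
@[ext]
structure MonoidVariety where
  /-- membership of a monoid in the variety -/
  Mem : ∀ (G : Type) [Monoid G], Prop
  mem_image : ∀ (G H : Type) [Monoid G] [Monoid H] (f : G →* H),
    Function.Surjective f → Mem G → Mem H
  mem_submonoid : ∀ (G : Type) [Monoid G] (S : Submonoid G), Mem G → Mem S
  mem_pi : ∀ (ι : Type) (G : ι → Type) [∀ i, Monoid (G i)],
    (∀ i, Mem (G i)) → Mem (∀ i, G i)

namespace MonoidVariety

/-- `V.IsSubvariety W`: every member of `V` is a member of `W`. -/
def IsSubvariety (V W : MonoidVariety) : Prop :=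
  ∀ (G : Type) [Monoid G], V.Mem G → W.Mem G

/-- The variety generated by the monoid `M`: the intersection of all varieties containing `M`. -/
def generatedBy (M : Type) [Monoid M] : MonoidVariety where
  Mem G _ := ∀ V : MonoidVariety, V.Mem M → V.Mem G
  mem_image G H _ _ f hf hG V hV := V.mem_image G H f hf (hG V hV)
  mem_submonoid G _ S hG V hV := V.mem_submonoid G S (hG V hV)
  mem_pi ι G _ hG V hV := V.mem_pi ι G (fun i => hG i V hV)

end MonoidVariety

/-- A monoid is of type `2 ^ ℵ₀` if the variety it generates contains uncountably many
subvarieties. -/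
def IsOfTypeContinuum (M : Type) [Monoid M] : Prop :=
  ¬ {V : MonoidVariety | V.IsSubvariety (MonoidVariety.generatedBy M)}.Countable

/-- The two generating letters. -/
inductive Letter : Type
  | a
  | e

/-- The free semigroup with zero on the two letters. -/
abbrev FreeZero : Type := WithZero (FreeSemigroup Letter)

/-- A letter as an element of the free semigroup with zero. -/
def letter (l : Letter) : FreeZero := ((FreeSemigroup.of l : FreeSemigroup Letter) : FreeZero)

/-- The defining relations `ee = e`, `aaa = 0`, `ae = 0`, `eaa = aa`. -/
inductive DefiningRel : FreeZero → FreeZero → Prop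
  | ee : DefiningRel (letter .e * letter .e) (letter .e)
  | aaa : DefiningRel (letter .a * letter .a * letter .a) 0
  | ae : DefiningRel (letter .a * letter .e) 0
  | eaa : DefiningRel (letter .e * letter .a * letter .a) (letter .a * letter .a)

/-- The semigroup with zero presented by `⟨a, e | ee = e, aaa = ae = 0, eaa = aa⟩`. -/
abbrev PresentedSemigroup : Type := (conGen DefiningRel).Quotient

/-- The monoid `⟨a, e | ee = e, aaa = ae = 0, eaa = aa⟩ ∪ {1}`: an identity element is adjoined
to the presented semigroup. -/
abbrev MonoidM : Type := WithOne PresentedSemigroup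

/-! Independent identities `intervalWord n ≈ overlapWord n` give one subvariety for each set of
natural numbers. The witness of independence is `FamilyMonoid n`, the syntactic monoid of the words
in which every interval of family `n` occurs twice and the first `x` precedes the last `y` exactly
when `x.1 ≤ y.2`.

It lies in the variety generated by `MonoidM`: substituting `a` for `x` and `e` for `y` tests
whether `x` occurs twice with no `y` after its first occurrence (`run_zero`), so values in the
six-element monoid determine whether a word realizes the family.

It satisfies the identities of every other family `m`. In a realizing word, a substitution instance
of either side contains both occurrences of each of its letters, so these letters form a module of
the interval order. That order is prime (`IsModule.eq_univ`), so the instance has at most one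
letter, and then both sides are powers of equal length, or it has all letters. The latter would
embed the order of family `n` into that of family `m`, against `eq_of_embedding`, or into one where
all intervals overlap.

It fails its own identity, so `A` is recovered from `familyVariety A`. -/

/-! ### The multiplication table -/

/-- A six-element monoid given by its multiplication table, isomorphic to `MonoidM`. -/
inductive Model : Type
  | one
  | e
  | a
  | ea
  | aa
  | zero
  deriving DecidableEq

namespace Model

instance : Fintype Model where
  elems := {one, e, a, ea, aa, zero}
  complete x := by cases x <;> decide

/-- The multiplication table. -/
def mul : Model → Model → Model
  | one, y => y
  | x, one => x
  | e, e => e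
  | e, a => ea
  | e, ea => ea
  | e, aa => aa
  | a, a => aa
  | ea, a => aa
  | _, _ => zero

instance : MonoidWithZero Model where
  mul := mul
  one := one
  zero := zero
  mul_assoc := by decide
  one_mul := by decide
  mul_one := by decide
  zero_mul := by decide
  mul_zero := by decide

/-- The right action on three states and a sink: `e` fixes `0`, and `a` maps `0 ↦ 1 ↦ 2`. -/
def act : Fin 4 → Model → Fin 4
  | s, one => s
  | 0, e => 0
  | 0, a => 1
  | 1, a => 2
  | 0, ea => 1
  | 0, aa => 2
  | _, _ => 3

theorem act_mul (s : Fin 4) (x y : Model) : act s (x * y) = act (act s x) y := by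
  revert s x y; decide

theorem act_one (s : Fin 4) : act s 1 = s := by
  revert s; decide

/-- The values of the generating letters. -/
def ofLetter : Letter → Model
  | .a => a
  | .e => e

/-- The extension of `ofLetter` to the free semigroup with zero. -/
def ofFreeZero : FreeZero →ₙ* Model where
  toFun w := WithZero.recZeroCoe 0 (FreeSemigroup.lift ofLetter) w
  map_mul' x y := by
    induction x using WithZero.recZeroCoe with
    | zero => simp
    | coe x =>
      induction y using WithZero.recZeroCoe with
      | zero => simp
      | coe y => rw [← WithZero.coe_mul]; exact map_mul (FreeSemigroup.lift ofLetter) x y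

theorem conGen_le_ker : conGen DefiningRel ≤ Con.ker ofFreeZero := by
  refine Con.conGen_le.2 ?_
  intro x y h
  cases h <;> rfl

/-- The projection of the presented semigroup onto the nonidentity part of the model. -/
def ofPresented : PresentedSemigroup →ₙ* Model where
  toFun q := Con.liftOn q ofFreeZero fun _ _ h => conGen_le_ker h
  map_mul' x y := by
    induction x, y using Con.induction_on₂ with
    | H x y => exact map_mul ofFreeZero x y

/-- The isomorphism from `MonoidM` to the model, as a homomorphism. -/
def ofMonoidM : MonoidM →* Model := WithOne.lift ofPresented

/-- The class of a letter in the presented semigroup. -/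
def gen (l : Letter) : PresentedSemigroup := ((letter l : FreeZero) : PresentedSemigroup)

/-- The class of zero in the presented semigroup. -/
def nul : PresentedSemigroup := ((0 : FreeZero) : PresentedSemigroup)

theorem nul_mul (x : PresentedSemigroup) : nul * x = nul := by
  induction x using Con.induction_on with
  | H x => exact congrArg _ (zero_mul x)

theorem mul_nul (x : PresentedSemigroup) : x * nul = nul := by
  induction x using Con.induction_on with
  | H x => exact congrArg _ (mul_zero x)

theorem gen_e_e : gen .e * gen .e = gen .e :=
  (Con.eq _).2 (ConGen.Rel.of _ _ DefiningRel.ee)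

theorem gen_a_e : gen .a * gen .e = nul :=
  (Con.eq _).2 (ConGen.Rel.of _ _ DefiningRel.ae)

theorem gen_a_a_a : gen .a * gen .a * gen .a = nul :=
  (Con.eq _).2 (ConGen.Rel.of _ _ DefiningRel.aaa)

theorem gen_e_a_a : gen .e * gen .a * gen .a = gen .a * gen .a :=
  (Con.eq _).2 (ConGen.Rel.of _ _ DefiningRel.eaa)

/-- The inverse of `ofMonoidM`, as a function. -/
def toMonoidM : Model → MonoidM
  | one => 1
  | e => (gen .e : PresentedSemigroup)
  | a => (gen .a : PresentedSemigroup)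
  | ea => ((gen .e * gen .a : PresentedSemigroup) : MonoidM)
  | aa => ((gen .a * gen .a : PresentedSemigroup) : MonoidM)
  | zero => (nul : PresentedSemigroup)

theorem ofMonoidM_toMonoidM (x : Model) : ofMonoidM (toMonoidM x) = x := by
  cases x <;> rfl

/-- Closure of the six normal forms under right multiplication by generators makes them exhaust the
monoid; the model keeps them distinct. -/
theorem exists_toMonoidM_of_mul_gen (x : Model) (l : Letter) :
    ∃ y, toMonoidM y = toMonoidM x * (gen l : PresentedSemigroup) := by
  have hea : gen .e * (gen .a * gen .a) = gen .a * gen .a := by rw [← mul_assoc, gen_e_a_a]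
  have ha3 : gen .a * (gen .a * gen .a) = nul := by rw [← mul_assoc, gen_a_a_a]
  cases l with
  | a =>
    cases x with
    | one => exact ⟨a, (one_mul _).symm⟩
    | e => exact ⟨ea, WithOne.coe_mul _ _⟩
    | a => exact ⟨aa, WithOne.coe_mul _ _⟩
    | ea => exact ⟨aa, (congrArg _ gen_e_a_a.symm).trans (WithOne.coe_mul _ _)⟩
    | aa => exact ⟨zero, (congrArg _ gen_a_a_a.symm).trans (WithOne.coe_mul _ _)⟩
    | zero => exact ⟨zero, (congrArg _ (nul_mul _).symm).trans (WithOne.coe_mul _ _)⟩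
  | e =>
    have h2 (x : PresentedSemigroup) : x * gen .a * gen .e = nul := by
      rw [mul_assoc, gen_a_e, mul_nul]
    cases x with
    | one => exact ⟨e, (one_mul _).symm⟩
    | e => exact ⟨e, (congrArg _ gen_e_e.symm).trans (WithOne.coe_mul _ _)⟩
    | a => exact ⟨zero, (congrArg _ gen_a_e.symm).trans (WithOne.coe_mul _ _)⟩
    | ea => exact ⟨zero, (congrArg _ (h2 _).symm).trans (WithOne.coe_mul _ _)⟩
    | aa => exact ⟨zero, (congrArg _ (h2 _).symm).trans (WithOne.coe_mul _ _)⟩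
    | zero => exact ⟨zero, (congrArg _ (nul_mul _).symm).trans (WithOne.coe_mul _ _)⟩

theorem exists_toMonoidM_of_mul (w : FreeSemigroup Letter) (x : Model) :
    ∃ y, toMonoidM y =
      toMonoidM x * (((w : FreeZero) : PresentedSemigroup) : MonoidM) := by
  induction w using FreeSemigroup.recOnMul generalizing x with
  | ih1 l => exact exists_toMonoidM_of_mul_gen x l
  | ih2 l w ih1 ih2 =>
    obtain ⟨y, hy⟩ := exists_toMonoidM_of_mul_gen x l
    obtain ⟨z, hz⟩ := ih2 y
    refine ⟨z, ?_⟩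
    rw [hz, hy, mul_assoc]
    rfl

theorem toMonoidM_surjective : Function.Surjective toMonoidM := by
  intro x
  induction x using WithOne.recOneCoe with
  | one => exact ⟨one, rfl⟩
  | coe x =>
    induction x using Con.induction_on with
    | H x =>
      induction x using WithZero.recZeroCoe with
      | zero => exact ⟨zero, rfl⟩
      | coe w =>
        obtain ⟨y, hy⟩ := exists_toMonoidM_of_mul w one
        exact ⟨y, hy.trans (one_mul _)⟩

theorem ofMonoidM_surjective : Function.Surjective ofMonoidM :=
  fun x => ⟨_, ofMonoidM_toMonoidM x⟩

end Model

theorem card_monoidM : Nat.card MonoidM = 6 := by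
  have h : Function.Bijective Model.toMonoidM :=
    ⟨Function.LeftInverse.injective Model.ofMonoidM_toMonoidM, Model.toMonoidM_surjective⟩
  rw [← Nat.card_congr (Equiv.ofBijective _ h), Nat.card_eq_fintype_card]
  rfl

/-! ### Primeness of the interval orders -/

/-- The interval family with index `n`: the unit intervals `[i, i + 1]` with `i ≤ n + 6` and
the two points `2` and `n + 5`. -/
def InFamily (n : ℕ) (x : ℕ × ℕ) : Prop :=
  (x.2 = x.1 + 1 ∧ x.1 ≤ n + 6) ∨ (x.1 = x.2 ∧ (x.1 = 2 ∨ x.1 = n + 5))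

theorem inFamily_unit {n i : ℕ} (hi : i ≤ n + 6) : InFamily n (i, i + 1) := Or.inl ⟨rfl, hi⟩

theorem inFamily_two (n : ℕ) : InFamily n (2, 2) := Or.inr ⟨rfl, Or.inl rfl⟩

theorem inFamily_last (n : ℕ) : InFamily n (n + 5, n + 5) := Or.inr ⟨rfl, Or.inr rfl⟩

/-- A set of intervals of the family that no further interval of the family separates, with
respect to the interval order. -/
def IsModule (n : ℕ) (D : ℕ × ℕ → Prop) : Prop :=
  ∀ x y z : ℕ × ℕ, D x → D y → InFamily n z → ¬ D z →
    ((z.1 ≤ x.2 ↔ z.1 ≤ y.2) ∧ (x.1 ≤ z.2 ↔ y.1 ≤ z.2))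

namespace IsModule

variable {n : ℕ} {D : ℕ × ℕ → Prop}

theorem mem_of_separates (hD : IsModule n D) {x y : ℕ × ℕ} (hx : D x) (hy : D y) (z : ℕ × ℕ)
    (hz : InFamily n z)
    (h : ¬ ((z.1 ≤ x.2 ↔ z.1 ≤ y.2) ∧ (x.1 ≤ z.2 ↔ y.1 ≤ z.2))) : D z := by
  by_contra hz'
  exact h (hD x y z hx hy hz hz')

theorem exists_consecutive_of_units (hD : IsModule n D) {i j : ℕ} (hij : i < j) (hj : j ≤ n + 6)
    (hi : D (i, i + 1)) (hj' : D (j, j + 1)) :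
    ∃ k, k + 1 ≤ n + 6 ∧ D (k, k + 1) ∧ D (k + 1, k + 1 + 1) := by
  -- At distance two the unit interval in between meets both and separates nothing, so a neighbour
  -- on the outer side is used.
  rcases (by omega : j = i + 1 ∨ i + 3 ≤ j ∨ (j = i + 2 ∧ i + 3 ≤ n + 6) ∨ (j = i + 2 ∧ 1 ≤ i))
    with h | h | ⟨h, h'⟩ | ⟨h, h'⟩
  · subst h
    exact ⟨i, hj, hi, hj'⟩
  · exact ⟨i, by omega, hi, hD.mem_of_separates hi hj' (i + 1, i + 1 + 1)
      (inFamily_unit (by omega)) (by simp only; omega)⟩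
  · subst h
    exact ⟨i + 2, by omega, hj', hD.mem_of_separates hi hj' (i + 2 + 1, i + 2 + 1 + 1)
      (inFamily_unit (by omega)) (by simp only; omega)⟩
  · obtain ⟨i, rfl⟩ := Nat.exists_eq_add_of_le' h'
    subst h
    exact ⟨i, by omega, hD.mem_of_separates hi hj' (i, i + 1)
      (inFamily_unit (by omega)) (by simp only; omega), hi⟩

theorem exists_consecutive_of_units_ne (hD : IsModule n D) {i j : ℕ} (hij : i ≠ j)
    (hi : i ≤ n + 6) (hj : j ≤ n + 6) (hi' : D (i, i + 1)) (hj' : D (j, j + 1)) :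
    ∃ k, k + 1 ≤ n + 6 ∧ D (k, k + 1) ∧ D (k + 1, k + 1 + 1) := by
  rcases lt_or_gt_of_ne hij with h | h
  · exact hD.exists_consecutive_of_units h hj hi' hj'
  · exact hD.exists_consecutive_of_units h hi hj' hi'

theorem exists_consecutive_of_point_of_unit (hD : IsModule n D) {c j : ℕ}
    (hc : c = 2 ∨ c = n + 5) (hj : j ≤ n + 6) (hc' : D (c, c)) (hj' : D (j, j + 1)) :
    ∃ k, k + 1 ≤ n + 6 ∧ D (k, k + 1) ∧ D (k + 1, k + 1 + 1) := by
  have key (i : ℕ) (hi : i ≤ n + 6) (hij : i ≠ j)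
      (h : ¬ ((i ≤ c ↔ i ≤ j + 1) ∧ (c ≤ i + 1 ↔ j ≤ i + 1))) :=
    hD.exists_consecutive_of_units_ne hij hi hj
      (hD.mem_of_separates hc' hj' (i, i + 1) (inFamily_unit hi) h) hj'
  -- In each case the chosen unit interval meets exactly one of the point and `[j, j + 1]`; it
  -- exists because `2 ≤ c ≤ n + 5`.
  rcases (by omega : j + 2 ≤ c ∨ j + 1 = c ∨ j = c ∨ c + 1 ≤ j) with h | h | h | h
  · exact key c (by omega) (by omega) (by omega)
  · exact key (c - 2) (by omega) (by omega) (by omega)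
  · exact key (c + 1) (by omega) (by omega) (by omega)
  · exact key (c - 1) (by omega) (by omega) (by omega)

theorem exists_consecutive (hD : IsModule n D) (hsub : ∀ x, D x → InFamily n x) {x y : ℕ × ℕ}
    (hx : D x) (hy : D y) (hxy : x ≠ y) :
    ∃ k, k + 1 ≤ n + 6 ∧ D (k, k + 1) ∧ D (k + 1, k + 1 + 1) := by
  obtain ⟨a, b⟩ := x
  obtain ⟨c, d⟩ := y
  have hxy' : a ≠ c ∨ b ≠ d := by
    by_contra! h
    exact hxy (Prod.ext h.1 h.2)
  rcases hsub _ hx with ⟨h1, h2⟩ | ⟨h1, h2⟩ <;> rcases hsub _ hy with ⟨h3, h4⟩ | ⟨h3, h4⟩ <;>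
    simp only at h1 h2 h3 h4 <;> subst h1 <;> subst h3
  · exact hD.exists_consecutive_of_units_ne (by omega) h2 h4 hx hy
  · exact hD.exists_consecutive_of_point_of_unit h4 h2 hy hx
  · exact hD.exists_consecutive_of_point_of_unit h2 h4 hx hy
  · exact hD.exists_consecutive_of_point_of_unit h2 (j := 2) (by omega) hx
      (hD.mem_of_separates hx hy (2, 2 + 1) (inFamily_unit (by omega)) (by simp only; omega))

/-- The interval order of the family is prime: its modules are trivial. -/
theorem eq_univ (hD : IsModule n D) (hsub : ∀ x, D x → InFamily n x) {x y : ℕ × ℕ}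
    (hx : D x) (hy : D y) (hxy : x ≠ y) (z : ℕ × ℕ) (hz : InFamily n z) : D z := by
  obtain ⟨k, hk, h1, h2⟩ := hD.exists_consecutive hsub hx hy hxy
  have up (j : ℕ) : k + 1 + j ≤ n + 6 →
      D (k + j, k + j + 1) ∧ D (k + j + 1, k + j + 1 + 1) := by
    induction j with
    | zero => exact fun _ => ⟨h1, h2⟩
    | succ j ih =>
      intro hj
      obtain ⟨h3, h4⟩ := ih (by omega)
      exact ⟨h4, hD.mem_of_separates h3 h4 _ (inFamily_unit (by omega)) (by simp only; omega)⟩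
  have down (j i : ℕ) : i + j = k → D (i, i + 1) ∧ D (i + 1, i + 1 + 1) := by
    induction j generalizing i with
    | zero => rintro rfl; exact ⟨h1, h2⟩
    | succ j ih =>
      intro hj
      obtain ⟨h3, h4⟩ := ih (i + 1) (by omega)
      exact ⟨hD.mem_of_separates h3 h4 _ (inFamily_unit (by omega)) (by simp only; omega), h3⟩
  have all (i : ℕ) (hi : i ≤ n + 6) : D (i, i + 1) := by
    rcases le_total i k with h | h
    · exact (down (k - i) i (by omega)).1
    · rcases h.eq_or_lt with rfl | h
      · exact h1
      · have := (up (i - 1 - k) (by omega)).2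
        rwa [show k + (i - 1 - k) + 1 = i by omega] at this
  obtain ⟨a, b⟩ := z
  rcases hz with ⟨h3, h4⟩ | ⟨h3, h4⟩ <;> simp only at h3 h4 <;> subst h3
  · exact all a h4
  -- The point `a` meets `[a - 1, a]` but not `[a - 2, a - 1]`.
  · exact hD.mem_of_separates (all (a - 2) (by omega)) (all (a - 1) (by omega)) _
      (Or.inr ⟨rfl, h4⟩) (by simp only; omega)

end IsModule

/-! ### Incomparability of the interval orders -/

/-- The interval orders of the families form an antichain under embeddings. -/
theorem eq_of_embedding {n m : ℕ} (f : ℕ × ℕ → ℕ × ℕ)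
    (hf : ∀ x, InFamily n x → InFamily m (f x))
    (h : ∀ x y, InFamily n x → InFamily n y → (x.1 ≤ y.2 ↔ (f x).1 ≤ (f y).2)) : n = m := by
  have hu (i : ℕ) (hi : i ≤ n + 6) := hf _ (inFamily_unit hi)
  have huu (i j : ℕ) (hi : i ≤ n + 6) (hj : j ≤ n + 6) :=
    h _ _ (inFamily_unit hi) (inFamily_unit hj)
  have hup (i : ℕ) (hi : i ≤ n + 6) := h _ _ (inFamily_unit hi) (inFamily_two n)
  have hpu (i : ℕ) (hi : i ≤ n + 6) := h _ _ (inFamily_two n) (inFamily_unit hi)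
  have huq (i : ℕ) (hi : i ≤ n + 6) := h _ _ (inFamily_unit hi) (inFamily_last n)
  have hqu (i : ℕ) (hi : i ≤ n + 6) := h _ _ (inFamily_last n) (inFamily_unit hi)
  have hp := hf _ (inFamily_two n)
  have hq := hf _ (inFamily_last n)
  unfold InFamily at hu hp hq
  simp only at hu huu hup hpu huq hqu hp hq
  -- Three pairwise overlapping intervals occur only around the two points. To the right of the last
  -- such triple there is no room for the images of `[3, 4]` and `[5, 6]`, so the first triple goes
  -- to the first.
  have start : (f (1, 1 + 1)).1 = 1 ∧ (f (1, 1 + 1)).2 = 2 ∧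
      (f (2, 2 + 1)).1 = 2 ∧ (f (2, 2 + 1)).2 = 3 := by
    have a0 := hu 0 (by omega)
    have a1 := hu 1 (by omega)
    have a2 := hu 2 (by omega)
    have a3 := hu 3 (by omega)
    have a5 := hu 5 (by omega)
    have b1 := huu 1 0 (by omega) (by omega)
    have b2 := huu 2 0 (by omega) (by omega)
    have b3 := hpu 0 (by omega)
    have b4 := huu 2 1 (by omega) (by omega)
    have b5 := hpu 1 (by omega)
    have b6 := huu 3 1 (by omega) (by omega)
    have b7 := hup 3 (by omega)
    have b8 := huu 3 2 (by omega) (by omega)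
    have b9 := huu 5 3 (by omega) (by omega)
    omega
  have main (j : ℕ) : j + 3 ≤ n + 6 →
      (f (j + 1, j + 1 + 1)).1 = j + 1 ∧ (f (j + 1, j + 1 + 1)).2 = j + 2 ∧
      (f (j + 2, j + 2 + 1)).1 = j + 2 ∧ (f (j + 2, j + 2 + 1)).2 = j + 3 := by
    induction j with
    | zero => exact fun _ => start
    | succ j ih =>
      intro hj
      obtain ⟨c1, c2, c3, c4⟩ := ih (by omega)
      have a1 := hu (j + 3) (by omega)
      have b1 := huu (j + 3) (j + 1) (by omega) (by omega)
      have b2 := huu (j + 3) (j + 2) (by omega) (by omega)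
      have b3 := huu (j + 4) (j + 3) (by omega) (by omega)
      have b4 := huu (j + 4) (j + 2) (by omega) (by omega)
      refine ⟨c3, c4, ?_⟩
      rw [show j + 1 + 2 = j + 3 by omega]
      omega
  -- The image of the point `n + 5` is now forced to be the point `n + 5`, which in family `m` must
  -- be `m + 5`.
  obtain ⟨c1, c2, c3, c4⟩ := main (n + 3) (by omega)
  have a1 := hu (n + 6) le_rfl
  have b1 := hqu (n + 3 + 1) (by omega)
  have b2 := huq (n + 3 + 2) (by omega)
  have b3 := hqu (n + 3) (by omega)
  have b4 := huq (n + 6) (by omega)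
  have b5 := huu (n + 6) (n + 3 + 2) (by omega) (by omega)
  obtain ⟨d1, d2, d3, d4⟩ := main (n + 2) (by omega)
  rw [show n + 2 + 1 = n + 3 by omega] at *
  omega

/-! ### Two-letter subsequences -/

open List in
theorem pair_sublist_append {α : Type*} {x y : α} {u v : List α} :
    [x, y] <+ u ++ v ↔ [x, y] <+ u ∨ (x ∈ u ∧ y ∈ v) ∨ [x, y] <+ v := by
  constructor
  · intro h
    obtain ⟨l₁, l₂, h, h1, h2⟩ := List.sublist_append_iff.1 h
    match l₁, h with
    | [], h => subst h; exact Or.inr (Or.inr h2)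
    | [_], h =>
      simp only [List.cons_append, List.nil_append, List.cons.injEq] at h
      obtain ⟨rfl, rfl⟩ := h
      exact Or.inr (Or.inl ⟨List.singleton_sublist.1 h1, List.singleton_sublist.1 h2⟩)
    | [_, _], h =>
      simp only [List.cons_append, List.nil_append, List.cons.injEq] at h
      obtain ⟨rfl, rfl, rfl⟩ := h
      exact Or.inl h1
    | _ :: _ :: _ :: _, h => simp at h
  · rintro (h | ⟨h1, h2⟩ | h)
    · exact h.trans (List.sublist_append_left _ _)
    · exact (List.singleton_sublist.2 h1).append (List.singleton_sublist.2 h2)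
    · exact h.trans (List.sublist_append_right _ _)

open List in
theorem exists_of_pair_sublist_flatMap {α β : Type*} {f : α → List β} {x y : β} {w : List α}
    (h : [x, y] <+ w.flatMap f) :
    (∃ i ∈ w, [x, y] <+ f i) ∨ ∃ i j, [i, j] <+ w ∧ x ∈ f i ∧ y ∈ f j := by
  induction w with
  | nil => simp at h
  | cons k w ih =>
    rw [List.flatMap_cons, pair_sublist_append] at h
    rcases h with h | ⟨h1, h2⟩ | h
    · exact Or.inl ⟨k, List.mem_cons_self, h⟩
    · obtain ⟨j, hj, hy⟩ := List.mem_flatMap.1 h2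
      exact Or.inr ⟨k, j, (List.singleton_sublist.2 hj).cons_cons k, h1, hy⟩
    · rcases ih h with ⟨i, hi, h⟩ | ⟨i, j, h, h1, h2⟩
      · exact Or.inl ⟨i, List.mem_cons_of_mem _ hi, h⟩
      · exact Or.inr ⟨i, j, h.trans (List.sublist_cons_self _ _), h1, h2⟩

open List in
theorem pair_sublist_flatMap {α β : Type*} {f : α → List β} {x y : β} {w : List α} {i j : α}
    (h : [i, j] <+ w) (hx : x ∈ f i) (hy : y ∈ f j) : [x, y] <+ w.flatMap f := by
  refine List.Sublist.trans ?_ (h.flatMap f)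
  simp only [List.flatMap_cons, List.flatMap_nil, List.append_nil]
  exact (List.singleton_sublist.2 hx).append (List.singleton_sublist.2 hy)

open List in
theorem pair_self_sublist_iff {α : Type*} [BEq α] [LawfulBEq α] {x : α} {w : List α} :
    [x, x] <+ w ↔ 2 ≤ w.count x :=
  List.replicate_sublist_iff (n := 2)

open List in
/-- Sorting a duplicate-free list into buckets permutes it. -/
theorem flatMap_filter_perm {α : Type*} {l : List α} (hl : l.Nodup) (g : α → ℕ) (N : ℕ)
    (hg : ∀ x ∈ l, g x < N) :
    (List.range N).flatMap (fun t => l.filter fun x => g x = t) ~ l := by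
  refine (List.perm_ext_iff_of_nodup ?_ hl).2 fun x => ?_
  · refine List.nodup_flatMap.2 ⟨fun t _ => hl.filter _, ?_⟩
    refine List.nodup_range.imp fun {s t} hst x hs ht => ?_
    simp only [List.mem_filter, decide_eq_true_eq] at hs ht
    exact hst (hs.2.symm.trans ht.2)
  · simp only [List.mem_flatMap, List.mem_range, List.mem_filter, decide_eq_true_eq]
    exact ⟨fun ⟨_, _, h, _⟩ => h, fun h => ⟨g x, hg x h, h, rfl⟩⟩

/-! ### The two words of a family -/

/-- The intervals of the family with index `n`, as a list. -/
def family (n : ℕ) : List (ℕ × ℕ) :=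
  (2, 2) :: (n + 5, n + 5) :: (List.range (n + 7)).map fun i => (i, i + 1)

theorem mem_family {n : ℕ} {x : ℕ × ℕ} : x ∈ family n ↔ InFamily n x := by
  obtain ⟨a, b⟩ := x
  simp only [family, InFamily, List.mem_cons, List.mem_map, List.mem_range, Prod.mk.injEq]
  constructor
  · rintro (⟨rfl, rfl⟩ | ⟨rfl, rfl⟩ | ⟨i, hi, rfl, rfl⟩)
    · simp
    · simp
    · exact Or.inl ⟨rfl, by omega⟩
  · rintro (⟨rfl, h⟩ | ⟨rfl, h | h⟩)
    · exact Or.inr (Or.inr ⟨a, by omega, rfl, rfl⟩)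
    · exact Or.inl ⟨h, h⟩
    · exact Or.inr (Or.inl ⟨h, h⟩)

theorem nodup_family (n : ℕ) : (family n).Nodup := by
  refine List.nodup_cons.2 ⟨by simp, List.nodup_cons.2 ⟨by simp, ?_⟩⟩
  exact List.nodup_range.map fun i j h => (Prod.mk.inj h).1

/-- The word listing, for each `t`, the intervals beginning at `t` and then those ending at `t`. -/
def intervalWord (n : ℕ) : List (ℕ × ℕ) :=
  (List.range (n + 8)).flatMap fun t =>
    ((family n).filter fun x => x.1 = t) ++ ((family n).filter fun x => x.2 = t)

/-- The word in which all intervals of the family overlap. -/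
def overlapWord (n : ℕ) : List (ℕ × ℕ) := family n ++ family n

open List in
theorem intervalWord_perm (n : ℕ) : intervalWord n ~ overlapWord n := by
  refine (List.flatMap_append_perm _ _ _).symm.trans (List.Perm.append ?_ ?_) <;>
  · refine flatMap_filter_perm (nodup_family n) _ _ fun x hx => ?_
    rcases mem_family.1 hx with h | h <;> omega

theorem mem_overlapWord {n : ℕ} {x : ℕ × ℕ} : x ∈ overlapWord n ↔ InFamily n x := by
  rw [overlapWord, List.mem_append, or_self, mem_family]

theorem count_overlapWord {n : ℕ} {x : ℕ × ℕ} (hx : InFamily n x) :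
    (overlapWord n).count x = 2 := by
  rw [overlapWord, List.count_append,
    List.count_eq_one_of_mem (nodup_family n) (mem_family.2 hx)]

open List in
theorem pair_sublist_overlapWord {n : ℕ} {x y : ℕ × ℕ} (hx : InFamily n x)
    (hy : InFamily n y) : [x, y] <+ overlapWord n :=
  pair_sublist_append.2 (Or.inr (Or.inl ⟨mem_family.2 hx, mem_family.2 hy⟩))

open List in
/-- The interval word determines the interval order of the family. -/
theorem pair_sublist_intervalWord {n : ℕ} {x y : ℕ × ℕ} (hx : InFamily n x)
    (hy : InFamily n y) : [x, y] <+ intervalWord n ↔ x.1 ≤ y.2 := by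
  have hle {z : ℕ × ℕ} (hz : InFamily n z) : z.1 ≤ z.2 ∧ z.2 < n + 8 := by
    rcases hz with h | h <;> omega
  constructor
  · intro h
    have key {z : ℕ × ℕ} {t : ℕ} (hz : InFamily n z)
        (h : z ∈ ((family n).filter fun x => x.1 = t) ++ ((family n).filter fun x => x.2 = t)) :
        z.1 ≤ t ∧ t ≤ z.2 := by
      have := hle hz
      simp only [List.mem_append, List.mem_filter, decide_eq_true_eq] at h
      omega
    rcases exists_of_pair_sublist_flatMap h with ⟨t, _, h⟩ | ⟨s, t, h, hs, ht⟩
    · exact (key hx (h.subset (by simp))).1.trans (key hy (h.subset (by simp))).2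
    · have hst : s < t := by
        have := List.pairwise_lt_range.sublist h
        simpa using this
      exact (key hx hs).1.trans (hst.le.trans (key hy ht).2)
  · intro h
    have hx' : x ∈ (family n).filter fun z => z.1 = x.1 := by simpa using mem_family.2 hx
    have hy' : y ∈ (family n).filter fun z => z.2 = y.2 := by simpa using mem_family.2 hy
    -- If `x.1 = y.2`, both letters lie in one bucket, where beginnings precede endings: touching
    -- closed intervals overlap.
    rcases h.eq_or_lt with h | h
    · have ht : [y.2] <+ List.range (n + 8) :=
        List.singleton_sublist.2 (List.mem_range.2 (hle hy).2)
      refine List.Sublist.trans ?_ (ht.flatMap _)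
      rw [List.flatMap_singleton]
      exact pair_sublist_append.2 (Or.inr (Or.inl ⟨h ▸ hx', hy'⟩))
    · refine pair_sublist_flatMap (i := x.1) (j := y.2) ?_ (List.mem_append_left _ hx')
        (List.mem_append_right _ hy')
      have := (hle hy).2
      rw [show n + 8 = y.2 + (n + 8 - y.2) by omega, List.range_add, pair_sublist_append]
      refine Or.inr (Or.inl ⟨List.mem_range.2 h, List.mem_map.2 ⟨0, ?_, rfl⟩⟩)
      exact List.mem_range.2 (by omega)

/-! ### Words realizing an interval order -/

/-- The word `w` realizes the interval order of the family with index `n`: each interval occurs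
twice, and `x` lies before `y` as intervals if and only if it does in `w`. -/
structure Realizes (n : ℕ) (w : List (ℕ × ℕ)) : Prop where
  mem : ∀ x ∈ w, InFamily n x
  count : ∀ x, InFamily n x → w.count x = 2
  sublist : ∀ x y, InFamily n x → InFamily n y → (List.Sublist [x, y] w ↔ x.1 ≤ y.2)

theorem realizes_intervalWord (n : ℕ) : Realizes n (intervalWord n) where
  mem _ hx := mem_overlapWord.1 ((intervalWord_perm n).subset hx)
  count x hx := ((intervalWord_perm n).count_eq x).trans (count_overlapWord hx)
  sublist _ _ hx hy := pair_sublist_intervalWord hx hy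

theorem not_realizes_overlapWord (n : ℕ) : ¬ Realizes n (overlapWord n) := by
  intro h
  have h1 := inFamily_unit (n := n) (i := 3) (by omega)
  have h2 := inFamily_unit (n := n) (i := 0) (by omega)
  have := (h.sublist _ _ h1 h2).1 (pair_sublist_overlapWord h1 h2)
  omega

namespace Realizes

variable {n m : ℕ} {p q s v : List (ℕ × ℕ)} {f : ℕ × ℕ → List (ℕ × ℕ)}

/-- Both occurrences of a letter of `q` lie in `q`. Hence an outside letter precedes it exactly when
it occurs in `p`, and follows it exactly when it occurs in `s`, whichever letter of `q` is taken. -/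
theorem isModule (h : Realizes n (p ++ q ++ s)) (hq : ∀ x ∈ q, 2 ≤ q.count x) :
    IsModule n (· ∈ q) := by
  have hps (x) (hx : x ∈ q) : x ∉ p ∧ x ∉ s := by
    have h1 := h.count x (h.mem x (by simp [hx]))
    have h2 := hq x hx
    simp only [List.count_append] at h1
    exact ⟨List.count_eq_zero.1 (by omega), List.count_eq_zero.1 (by omega)⟩
  have left (x z) (hx : x ∈ q) (hz : InFamily n z) (hz' : z ∉ q) : z.1 ≤ x.2 ↔ z ∈ p := by
    rw [← h.sublist z x hz (h.mem x (by simp [hx])), List.append_assoc]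
    have hnot (r : List (ℕ × ℕ)) (hr : z ∉ r ∨ x ∉ r) : ¬ List.Sublist [z, x] r := fun h =>
      hr.elim (fun hr => hr (h.subset (by simp))) (fun hr => hr (h.subset (by simp)))
    simp [pair_sublist_append, hnot p (Or.inr (hps x hx).1), hnot s (Or.inr (hps x hx).2),
      hnot q (Or.inl hz'), hx, hz', (hps x hx).2]
  have right (x z) (hx : x ∈ q) (hz : InFamily n z) (hz' : z ∉ q) : x.1 ≤ z.2 ↔ z ∈ s := by
    rw [← h.sublist x z (h.mem x (by simp [hx])) hz]
    have hnot (r : List (ℕ × ℕ)) (hr : z ∉ r ∨ x ∉ r) : ¬ List.Sublist [x, z] r := fun h =>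
      hr.elim (fun hr => hr (h.subset (by simp))) (fun hr => hr (h.subset (by simp)))
    simp [pair_sublist_append, hnot p (Or.inr (hps x hx).1), hnot s (Or.inr (hps x hx).2),
      hnot q (Or.inl hz'), hx, hz', (hps x hx).1]
  intro x y z hx hy hz hz'
  exact ⟨(left x z hx hz hz').trans (left y z hy hz hz').symm,
    (right x z hx hz hz').trans (right y z hy hz hz').symm⟩

/-- Each letter of `v` occurs twice, so a letter shared by two distinct blocks would occur at least
four times. -/
theorem eq_of_mem_of_mem (h : Realizes n (p ++ v.flatMap f ++ s))
    (hv : v.Perm (overlapWord m)) {x i j : ℕ × ℕ} (hi : i ∈ v) (hj : j ∈ v) (hxi : x ∈ f i)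
    (hxj : x ∈ f j) : i = j := by
  by_contra hij
  have hx : InFamily n x :=
    h.mem x (by simpa using Or.inr (Or.inl ⟨i.1, i.2, hi, hxi⟩))
  have h1 := h.count x hx
  have h2 : ((overlapWord m).flatMap f).count x = (v.flatMap f).count x :=
    ((hv.flatMap_right f).count_eq x).symm
  simp only [List.count_append] at h1
  rw [overlapWord, List.flatMap_append, List.count_append] at h2
  have hi' : i ∈ family m := mem_family.2 (mem_overlapWord.1 (hv.subset hi))
  have hj' : j ∈ family m := mem_family.2 (mem_overlapWord.1 (hv.subset hj))
  have h3 := (((List.perm_cons_erase hi').trans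
    ((List.perm_cons_erase ((List.mem_erase_of_ne (Ne.symm hij)).2 hj')).cons i)).flatMap_right
      f).count_eq x
  simp only [List.flatMap_cons, List.count_append] at h3
  have h4 := List.count_pos_iff.2 hxi
  have h5 := List.count_pos_iff.2 hxj
  omega

/-- A substitution instance of the words of another family that occurs in a word realizing the
interval order of the family with index `n` has at most one letter. -/
theorem eq_of_mem_flatMap (h : Realizes n (p ++ v.flatMap f ++ s)) (hnm : n ≠ m)
    (hv : v = intervalWord m ∨ v = overlapWord m) {x y : ℕ × ℕ} (hx : x ∈ v.flatMap f)
    (hy : y ∈ v.flatMap f) : x = y := by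
  by_contra hxy
  have hvp : v.Perm (overlapWord m) := by
    rcases hv with rfl | rfl
    · exact intervalWord_perm m
    · exact List.Perm.refl _
  have hvm {i} (hi : i ∈ v) : InFamily m i := mem_overlapWord.1 (hvp.subset hi)
  have hself {i} (hi : i ∈ v) : List.Sublist [i, i] v := by
    rw [pair_self_sublist_iff, hvp.count_eq, count_overlapWord (hvm hi)]
  have hmod : IsModule n (· ∈ v.flatMap f) := by
    refine h.isModule fun z hz => ?_
    obtain ⟨i, hi, hz⟩ := List.mem_flatMap.1 hz
    exact pair_self_sublist_iff.1 (pair_sublist_flatMap (hself hi) hz hz)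
  have hall := hmod.eq_univ (fun z hz => h.mem z (by
    rw [List.mem_append, List.mem_append]; exact Or.inl (Or.inr hz))) hx hy hxy
  -- `g z` is the letter of `v` whose block contains `z`; its value outside the family is
  -- immaterial.
  have hex (z) : ∃ i, InFamily n z → i ∈ v ∧ z ∈ f i := by
    by_cases hz : InFamily n z
    · obtain ⟨i, hi, hz'⟩ := List.mem_flatMap.1 (hall z hz)
      exact ⟨i, fun _ => ⟨hi, hz'⟩⟩
    · exact ⟨z, fun h => absurd h hz⟩
  choose g hg using hex
  have hsub (z t) (hz : InFamily n z) (ht : InFamily n t) :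
      z.1 ≤ t.2 ↔ List.Sublist [g z, g t] v := by
    rw [← h.sublist z t hz ht]
    constructor
    · intro hzt
      have hzt' : List.Sublist [z, t] (v.flatMap f) := by
        have hc (z) (hz : InFamily n z) : z ∉ p ∧ z ∉ s := by
          have h1 := h.count z hz
          have h2 := pair_self_sublist_iff.1
            (pair_sublist_flatMap (hself (hg z hz).1) (hg z hz).2 (hg z hz).2)
          simp only [List.count_append] at h1
          exact ⟨List.count_eq_zero.1 (by omega), List.count_eq_zero.1 (by omega)⟩
        rcases pair_sublist_append.1 hzt with hzt | ⟨_, ht'⟩ | hzt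
        · rcases pair_sublist_append.1 hzt with hzt | ⟨hz', _⟩ | hzt
          · exact absurd (hzt.subset (by simp)) (hc z hz).1
          · exact absurd hz' (hc z hz).1
          · exact hzt
        · exact absurd ht' (hc t ht).2
        · exact absurd (hzt.subset (by simp)) (hc z hz).2
      rcases exists_of_pair_sublist_flatMap hzt' with ⟨i, hi, hzt⟩ | ⟨i, j, hij, hi, hj⟩
      · rw [h.eq_of_mem_of_mem hvp (hg z hz).1 hi (hg z hz).2 (hzt.subset (by simp)),
          h.eq_of_mem_of_mem hvp (hg t ht).1 hi (hg t ht).2 (hzt.subset (by simp))]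
        exact hself hi
      · rwa [h.eq_of_mem_of_mem hvp (hg z hz).1 (hij.subset (by simp)) (hg z hz).2 hi,
          h.eq_of_mem_of_mem hvp (hg t ht).1 (hij.subset (by simp)) (hg t ht).2 hj]
    · intro hzt
      exact (pair_sublist_flatMap hzt (hg z hz).2 (hg t ht).2).trans
        ((List.sublist_append_right _ _).trans (List.sublist_append_left _ _))
  -- Now `g` embeds the order of family `n` into the order read off `v`. In the overlap word every
  -- pair is a subsequence, although `[3, 4]` lies to the right of `[0, 1]`.
  rcases hv with rfl | rfl
  · refine hnm (eq_of_embedding g (fun z hz => hvm (hg z hz).1) fun z t hz ht => ?_)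
    rw [hsub z t hz ht, pair_sublist_intervalWord (hvm (hg z hz).1) (hvm (hg t ht).1)]
  · have h1 := inFamily_unit (n := n) (i := 3) (by omega)
    have h2 := inFamily_unit (n := n) (i := 0) (by omega)
    have := (hsub _ _ h1 h2).2
      (pair_sublist_overlapWord (hvm (hg _ h1).1) (hvm (hg _ h2).1))
    omega

/-- In a realizing word, substitution instances of the two words of another family are equal. -/
theorem flatMap_eq (h : Realizes n (p ++ v.flatMap f ++ s)) (hnm : n ≠ m)
    (hv : v = intervalWord m ∨ v = overlapWord m) :
    (intervalWord m).flatMap f = (overlapWord m).flatMap f := by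
  have hperm := (intervalWord_perm m).flatMap_right f
  have hmem {x} (hx : x ∈ (overlapWord m).flatMap f) : x ∈ v.flatMap f := by
    rcases hv with rfl | rfl
    · exact hperm.symm.subset hx
    · exact hx
  rcases hl : (overlapWord m).flatMap f with _ | ⟨c, l⟩
  · rw [hl] at hperm
    exact hperm.eq_nil
  · have hc : c ∈ v.flatMap f := hmem (by simp [hl])
    have h1 := List.eq_replicate_of_mem fun x (hx : x ∈ (overlapWord m).flatMap f) =>
      h.eq_of_mem_flatMap hnm hv (hmem hx) hc
    have h2 := List.eq_replicate_of_mem fun x (hx : x ∈ (intervalWord m).flatMap f) =>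
      h.eq_of_mem_flatMap hnm hv (hmem (hperm.subset hx)) hc
    rw [h2, ← hl, h1, hperm.length_eq]

end Realizes

/-! ### Reading words with the six-element monoid -/

namespace Model

/-- The substitution `x ↦ a`, `z ↦ e` that maps all other letters to `1`. -/
def subst (x z y : ℕ × ℕ) : Model := if y = x then a else if y = z then e else 1

/-- The state reached from `s` by reading a word under the substitution `subst x z`. -/
def run (x z : ℕ × ℕ) (s : Fin 4) (w : List (ℕ × ℕ)) : Fin 4 :=
  act s (w.map (subst x z)).prod

theorem run_nil (x z : ℕ × ℕ) (s : Fin 4) : run x z s [] = s := act_one s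

theorem run_cons (x z : ℕ × ℕ) (s : Fin 4) (y : ℕ × ℕ) (w : List (ℕ × ℕ)) :
    run x z s (y :: w) = run x z (act s (subst x z y)) w := by
  rw [run, List.map_cons, List.prod_cons, act_mul, run]

theorem run_three (x z : ℕ × ℕ) (w : List (ℕ × ℕ)) : run x z 3 w = 3 := by
  induction w with
  | nil => exact run_nil x z 3
  | cons y w ih =>
    rw [run_cons, show act 3 (subst x z y) = 3 from ?_, ih]
    generalize subst x z y = t
    cases t <;> rfl

theorem run_two (x z : ℕ × ℕ) (w : List (ℕ × ℕ)) :
    run x z 2 w = 2 ↔ w.count x = 0 ∧ (z ≠ x → z ∉ w) := by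
  induction w with
  | nil => simp [run_nil]
  | cons y w ih =>
    rw [run_cons, subst]
    split_ifs with h1 h2
    · subst h1
      rw [show act 2 a = 3 from rfl, run_three]
      simp
    · subst h2
      rw [show act 2 e = 3 from rfl, run_three]
      simp [h1]
    · rw [act_one, ih, List.count_cons_of_ne h1]
      simp [Ne.symm h2]

theorem run_one (x z : ℕ × ℕ) (w : List (ℕ × ℕ)) :
    run x z 1 w = 2 ↔ w.count x = 1 ∧ (z ≠ x → z ∉ w) := by
  induction w with
  | nil => simp [run_nil]
  | cons y w ih =>
    rw [run_cons, subst]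
    split_ifs with h1 h2
    · subst h1
      rw [show act 1 a = 2 from rfl, run_two]
      simp +contextual [List.count_eq_zero]
    · subst h2
      rw [show act 1 e = 3 from rfl, run_three]
      simp [h1]
    · rw [act_one, ih, List.count_cons_of_ne h1]
      simp [Ne.symm h2]

open List in
theorem _root_.pair_sublist_cons_of_ne {α : Type*} {x y z : α} {w : List α} (h : y ≠ x) :
    [x, z] <+ y :: w ↔ [x, z] <+ w :=
  ⟨fun h' => (List.sublist_cons_iff.1 h').elim id
    fun ⟨_, h1, _⟩ => absurd (List.cons.inj h1).1.symm h, fun h' => h'.cons y⟩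

-- The state counts the letters `x`, and `e` leads to the sink except in state `0`. For `z = x` no
-- `e` is substituted and only the count is tested.
open List in
theorem run_zero (x z : ℕ × ℕ) (w : List (ℕ × ℕ)) :
    run x z 0 w = 2 ↔ w.count x = 2 ∧ (z ≠ x → ¬ [x, z] <+ w) := by
  induction w with
  | nil => simp [run_nil]
  | cons y w ih =>
    rw [run_cons, subst]
    split_ifs with h1 h2
    · subst h1
      rw [show act 0 a = 1 from rfl, run_one]
      simp
    · rw [show act 0 e = 0 from rfl, List.count_cons_of_ne h1, pair_sublist_cons_of_ne h1]
      exact ih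
    · rw [act_one, List.count_cons_of_ne h1, pair_sublist_cons_of_ne h1]
      exact ih

theorem run_self_two_ne_zero (x : ℕ × ℕ) (w : List (ℕ × ℕ)) : run x x 2 w ≠ 0 := by
  induction w with
  | nil => simp [run_nil]
  | cons y w ih =>
    rw [run_cons, subst]
    split_ifs
    · rw [show act 2 a = 3 from rfl, run_three]; decide
    · rwa [act_one]

theorem run_self_one_ne_zero (x : ℕ × ℕ) (w : List (ℕ × ℕ)) : run x x 1 w ≠ 0 := by
  induction w with
  | nil => simp [run_nil]
  | cons y w ih =>
    rw [run_cons, subst]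
    split_ifs
    · exact run_self_two_ne_zero x w
    · rwa [act_one]

theorem run_self_zero (x : ℕ × ℕ) (w : List (ℕ × ℕ)) : run x x 0 w = 0 ↔ w.count x = 0 := by
  induction w with
  | nil => simp [run_nil]
  | cons y w ih =>
    rw [run_cons, subst]
    split_ifs with h
    · subst h
      rw [show act 0 a = 1 from rfl]
      simpa using run_self_one_ne_zero y w
    · rw [act_one, List.count_cons_of_ne h]
      exact ih

/-- Words with equal values in the model under all substitutions realize the same families. -/
theorem realizes_of_forall_prod_eq {n : ℕ} {u w : List (ℕ × ℕ)}
    (h : ∀ g : ℕ × ℕ → Model, (u.map g).prod = (w.map g).prod) (hu : Realizes n u) :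
    Realizes n w := by
  have hrun (x z : ℕ × ℕ) (s : Fin 4) : run x z s u = run x z s w := by
    rw [run, run, h]
  have hcount (x) (hx : InFamily n x) : w.count x = 2 := by
    have := run_zero x x w
    rw [← hrun, run_zero] at this
    exact (this.1 ⟨hu.count x hx, fun h => absurd rfl h⟩).1
  refine ⟨fun x hx => hu.mem x ?_, hcount, fun x y hx hy => ?_⟩
  · by_contra hxu
    have := run_self_zero x w
    rw [← hrun, run_self_zero, List.count_eq_zero, List.count_eq_zero] at this
    exact this.1 hxu hx
  · rw [← hu.sublist x y hx hy]
    by_cases hxy : y = x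
    · subst hxy
      rw [pair_self_sublist_iff, pair_self_sublist_iff, hcount y hx, hu.count y hx]
    · have := run_zero x y w
      rw [← hrun, run_zero, hcount x hx, hu.count x hx] at this
      simpa [hxy, not_iff_not] using this.symm

end Model

/-! ### Identities and varieties -/

/-- The monoid `G` satisfies the identity `u ≈ v`. -/
def SatisfiesIdentity {α : Type*} (G : Type*) [Monoid G] (u v : List α) : Prop :=
  ∀ g : α → G, (u.map g).prod = (v.map g).prod

namespace SatisfiesIdentity

variable {α : Type*} {u v : List α}

theorem of_surjective {G H : Type*} [Monoid G] [Monoid H] (h : SatisfiesIdentity G u v)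
    (f : G →* H) (hf : Function.Surjective f) : SatisfiesIdentity H u v := by
  intro g
  choose k hk using fun x => hf (g x)
  have hg : g = f ∘ k := funext fun x => (hk x).symm
  rw [hg, ← List.map_map, ← List.map_map, ← map_list_prod, ← map_list_prod, h k]

theorem of_injective {G H : Type*} [Monoid G] [Monoid H] (h : SatisfiesIdentity H u v)
    (f : G →* H) (hf : Function.Injective f) : SatisfiesIdentity G u v := by
  intro g
  apply hf
  rw [map_list_prod, map_list_prod, List.map_map, List.map_map]
  exact h _

theorem pi {ι : Type*} {G : ι → Type*} [∀ i, Monoid (G i)]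
    (h : ∀ i, SatisfiesIdentity (G i) u v) : SatisfiesIdentity (∀ i, G i) u v := by
  intro g
  funext i
  have := h i (fun x => g x i)
  rw [Pi.list_prod_apply, Pi.list_prod_apply, List.map_map, List.map_map]
  exact this

end SatisfiesIdentity

namespace MonoidVariety

/-- The subvariety of `V` defined by a set of identities. -/
def withIdentities {α : Type} (V : MonoidVariety) (I : Set (List α × List α)) :
    MonoidVariety where
  Mem G _ := V.Mem G ∧ ∀ i ∈ I, SatisfiesIdentity G i.1 i.2
  mem_image G H _ _ f hf hG :=
    ⟨V.mem_image G H f hf hG.1, fun i hi => (hG.2 i hi).of_surjective f hf⟩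
  mem_submonoid G _ S hG :=
    ⟨V.mem_submonoid G S hG.1, fun i hi => (hG.2 i hi).of_injective S.subtype
      Subtype.val_injective⟩
  mem_pi ι G _ hG :=
    ⟨V.mem_pi ι G fun i => (hG i).1, fun i hi => SatisfiesIdentity.pi fun j => (hG j).2 i hi⟩

theorem withIdentities_isSubvariety {α : Type} (V : MonoidVariety)
    (I : Set (List α × List α)) : (V.withIdentities I).IsSubvariety V :=
  fun _ _ h => h.1

/-- A quotient of a free monoid by a congruence containing all identities of a member of `V`
belongs to `V`. -/
theorem mem_quotient (V : MonoidVariety) {G : Type} [Monoid G] (hG : V.Mem G) {α : Type}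
    (c : Con (FreeMonoid α))
    (hc : ∀ u v : FreeMonoid α, (∀ g : FreeMonoid α →* G, g u = g v) → c u v) :
    V.Mem c.Quotient := by
  -- The kernel of `F` consists of the identities of `G`, and its range is a submonoid of a power of
  -- `G`.
  let F : FreeMonoid α →* ((FreeMonoid α →* G) → G) := MonoidHom.pi fun g => g
  have hF : Con.ker F ≤ c := fun u v h => hc u v fun g => congrFun h g
  refine V.mem_image _ _ ((Con.map _ c hF).comp
    (Con.quotientKerEquivRange F).symm.toMonoidHom) ?_
    (V.mem_submonoid _ (MonoidHom.mrange F) (V.mem_pi _ _ fun _ => hG))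
  refine Function.Surjective.comp (g := Con.map _ c hF) ?_
    (Con.quotientKerEquivRange F).symm.surjective
  intro x
  induction x using Con.induction_on with
  | H x => exact ⟨(x : (Con.ker F).Quotient), rfl⟩

theorem mem_generatedBy (G : Type) [Monoid G] : (generatedBy G).Mem G := fun _ h => h

end MonoidVariety

/-! ### Syntactic monoids and independence -/

/-- The syntactic congruence of a set of words. -/
def syntacticCon {α : Type*} (L : Set (List α)) : Con (FreeMonoid α) where
  r u v := ∀ p s : FreeMonoid α,
    (p * u * s).toList ∈ L ↔ (p * v * s).toList ∈ L
  iseqv := ⟨fun _ _ _ => Iff.rfl, fun h p s => (h p s).symm,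
    fun h h' p s => (h p s).trans (h' p s)⟩
  mul' := by
    intro u v u' v' h h' p s
    have h1 := h p (u' * s)
    have h2 := h' (p * v) s
    simp only [mul_assoc] at h1 h2 ⊢
    exact h1.trans h2

theorem FreeMonoid.toList_prod_map {α β : Type*} (f : α → FreeMonoid β) (w : List α) :
    ((w.map f).prod).toList = w.flatMap fun x => (f x).toList := by
  induction w with
  | nil => rfl
  | cons x w ih => rw [List.map_cons, List.prod_cons, FreeMonoid.toList_mul, ih, List.flatMap_cons]

/-- The syntactic monoid of the words realizing the family with index `n`. -/
abbrev FamilyMonoid (n : ℕ) : Type := (syntacticCon {w | Realizes n w}).Quotient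

theorem mem_familyMonoid (n : ℕ) :
    (MonoidVariety.generatedBy MonoidM).Mem (FamilyMonoid n) := by
  have hM : (MonoidVariety.generatedBy MonoidM).Mem Model :=
    MonoidVariety.mem_image _ _ _ Model.ofMonoidM Model.ofMonoidM_surjective
      (MonoidVariety.mem_generatedBy _)
  refine MonoidVariety.mem_quotient _ hM _ fun u v h p s => ?_
  have key (g : ℕ × ℕ → Model) :
      ((p * u * s).toList.map g).prod = ((p * v * s).toList.map g).prod := by
    rw [← FreeMonoid.lift_apply, ← FreeMonoid.lift_apply]
    simp only [map_mul, h]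
  exact ⟨Model.realizes_of_forall_prod_eq key,
    Model.realizes_of_forall_prod_eq fun g => (key g).symm⟩

/-- A substitution lifts to words. If either side in some context is realizing, the two instances
are the same word by `Realizes.flatMap_eq`. -/
theorem familyMonoid_satisfies {n m : ℕ} (hnm : n ≠ m) :
    SatisfiesIdentity (FamilyMonoid n) (intervalWord m) (overlapWord m) := by
  intro g
  choose f hf using fun x => (Con.mk'_surjective (c := syntacticCon {w | Realizes n w})) (g x)
  have hg : g = Con.mk' (syntacticCon {w | Realizes n w}) ∘ f := funext fun x => (hf x).symm
  rw [hg, ← List.map_map, ← List.map_map, ← map_list_prod, ← map_list_prod]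
  refine (Con.eq _).2 fun p s => ?_
  simp only [FreeMonoid.toList_mul, FreeMonoid.toList_prod_map, Set.mem_ofPred_eq]
  constructor
  · intro h
    rwa [← h.flatMap_eq hnm (Or.inl rfl)]
  · intro h
    rwa [h.flatMap_eq hnm (Or.inr rfl)]

theorem familyMonoid_not_satisfies (n : ℕ) :
    ¬ SatisfiesIdentity (FamilyMonoid n) (intervalWord n) (overlapWord n) := by
  intro h
  have h1 := h fun x => Con.mk' (syntacticCon {w | Realizes n w}) (FreeMonoid.of x)
  have h2 (w : List (ℕ × ℕ)) : (w.map fun x => Con.mk' (syntacticCon {w | Realizes n w})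
      (FreeMonoid.of x)).prod = Con.mk' (syntacticCon {w | Realizes n w}) (FreeMonoid.ofList w) := by
    induction w with
    | nil => rfl
    | cons x w ih =>
      rw [List.map_cons, List.prod_cons, ih, ← map_mul]
      rfl
  rw [h2, h2] at h1
  -- The empty context already distinguishes the two words.
  have h3 := ((Con.eq _).1 h1 1 1)
  simp only [one_mul, mul_one, FreeMonoid.toList_ofList, Set.mem_ofPred_eq] at h3
  exact not_realizes_overlapWord n (h3.1 (realizes_intervalWord n))

/-! ### Uncountably many subvarieties -/

/-- The subvariety defined by the identities of the families with index in `A`. -/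
def familyVariety (A : Set ℕ) : MonoidVariety :=
  (MonoidVariety.generatedBy MonoidM).withIdentities
    ((fun n => (intervalWord n, overlapWord n)) '' A)

theorem familyVariety_mem_iff (A : Set ℕ) (n : ℕ) :
    (familyVariety A).Mem (FamilyMonoid n) ↔ n ∉ A := by
  constructor
  · exact fun h hn => familyMonoid_not_satisfies n (h.2 _ ⟨n, hn, rfl⟩)
  · refine fun hn => ⟨mem_familyMonoid n, ?_⟩
    rintro _ ⟨m, hm, rfl⟩
    exact familyMonoid_satisfies fun h => hn (h ▸ hm)

theorem familyVariety_injective : Function.Injective familyVariety := by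
  intro A B h
  ext n
  rw [← not_iff_not, ← familyVariety_mem_iff, ← familyVariety_mem_iff, h]

theorem isOfTypeContinuum_monoidM : IsOfTypeContinuum MonoidM := by
  intro h
  have h1 : (Set.range familyVariety).Countable := h.mono <| by
    rintro _ ⟨A, rfl⟩
    exact MonoidVariety.withIdentities_isSubvariety _ _
  have h2 : (Set.univ : Set (Set ℕ)).Countable :=
    Set.countable_of_injective_of_countable_image familyVariety_injective.injOn
      (by rwa [Set.image_univ])
  obtain ⟨f, hf⟩ := (Set.countable_univ_iff.1 h2).exists_injective_nat
  exact Function.cantor_injective f hf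

theorem corollary2 : Nat.card MonoidM = 6 ∧ IsOfTypeContinuum MonoidM :=
  ⟨card_monoidM, isOfTypeContinuum_monoidM⟩
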